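/- A \emph{diversity} is a pair $(X,\delta)$ where $X$ is a set and $\delta$ is a real-valued function on the finite subsets of $X$ such that $\delta(A)\ge 0$, with $\delta(A)=0$ if and only if $|A|\le 1$, and $\delta(A\cup C)\le\delta(A\cup B)+\delta(B\cup C)$ for all finite $A,B,C\subseteq X$ with $B\neq\emptyset$; it is finite if $X$ is finite. A map $f:X_1\to X_2$ is an \emph{isometric embedding} of $(X_1,\delta_1)$ into $(X_2,\delta_2)$ if $\delta_2(f(A))=\delta_1(A)$ for all finite $A\subseteq X_1$. A diversity $(\mathbb R^k,\delta)$ is \emph{linear} if $\delta(\lambda A)=\lambda\,\delta(A)$ and $\delta(A+B)=\delta(A)+\delta(B)$ for all $\lambda\ge 0$ and all nonempty finite $A,B\subseteq\mathbb R^k$, where $A+B$ is the Minkowski sum. For a closed convex set $K\subseteq\mathbb R^k$ with nonempty interior, the \emph{Minkowski diversity} $(\mathbb R^k,\delta_K)$ with kernel $K$ is given by $$\delta_K(A)=\inf\{\lambda\ge 0: A\subseteq\lambda K+x\text{ for some }x\in\mathbb R^k\}$$ for finite $A\subseteq\mathbb R^k$. A \emph{simplex} is the convex hull of a nonempty finite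 affinely independent set of points. \textbf{Theorem.} Let $(X,\delta)$ be a finite diversity. The following are equivalent: \begin{enumerate} \item[(i)] For some $k \ge 0$ there is an isometric embedding of $(X,\delta)$ into a linear diversity on $\mathbb R^k$. \item[(ii)] $(X,\delta)$ has negative type, that is, $$\sum_{A,B\subseteq X}x_A\,x_B\,\delta(A\cup B)\le 0$$ for all real vectors $(x_A)_{A\subseteq X}$ with $\sum_{A\subseteq X}x_A=0$ and $x_\emptyset=0$. \item[(iii)] For some $k \ge 0$ there is an isometric embedding of $(X,\delta)$ into a Minkowski diversity $(\mathbb R^k,\delta_K)$ whose kernel $K\subseteq\mathbb R^k$ is a simplex (with nonempty interior, as for every kernel). \end{enumerate} -/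

import Mathlib

open scoped Pointwise

namespace Diversity

open scoped Classical in
/-- `δ` is a diversity on `X`: (D1) it is nonnegative and vanishes exactly on the sets with at most
one point, and (D2) it satisfies the triangle inequality through every nonempty set `B`. -/
structure IsDiversity {X : Type*} (δ : Finset X → ℝ) : Prop where
  nonneg : ∀ A : Finset X, 0 ≤ δ A
  eq_zero_iff : ∀ A : Finset X, δ A = 0 ↔ A.card ≤ 1
  triangle : ∀ A B C : Finset X, B.Nonempty → δ (A ∪ C) ≤ δ (A ∪ B) + δ (B ∪ C)

open scoped Classical in
/-- `f` is an isometric embedding of `(X, δ₁)` into `(Y, δ₂)`. -/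
def IsIsometricEmbedding {X Y : Type*} (δ₁ : Finset X → ℝ) (δ₂ : Finset Y → ℝ) (f : X → Y) :
    Prop :=
  ∀ A : Finset X, δ₂ (A.image f) = δ₁ A

open scoped Classical in
/-- `δ` is Minkowski linear on the nonempty finite subsets of `ℝ^k`. -/
structure IsMinkowskiLinear {k : ℕ} (δ : Finset (EuclideanSpace ℝ (Fin k)) → ℝ) : Prop where
  smul : ∀ (c : ℝ) (A : Finset (EuclideanSpace ℝ (Fin k))), 0 ≤ c → A.Nonempty →
    δ (c • A) = c * δ A
  add : ∀ A B : Finset (EuclideanSpace ℝ (Fin k)), A.Nonempty → B.Nonempty →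
    δ (A + B) = δ A + δ B

/-- `(X, δ)` embeds isometrically into a linear diversity on some `ℝ^k`. -/
def IsLinearEmbeddable {X : Type*} (δ : Finset X → ℝ) : Prop :=
  ∃ (k : ℕ) (δ' : Finset (EuclideanSpace ℝ (Fin k)) → ℝ) (f : X → EuclideanSpace ℝ (Fin k)),
    IsDiversity δ' ∧ IsMinkowskiLinear δ' ∧ IsIsometricEmbedding δ δ' f

open scoped Classical in
/-- The finite diversity `(X, δ)` has negative type. -/
def HasNegativeType {X : Type*} [Fintype X] (δ : Finset X → ℝ) : Prop :=
  ∀ x : Finset X → ℝ, x ∅ = 0 → ∑ A, x A = 0 → ∑ A, ∑ B, x A * x B * δ (A ∪ B) ≤ 0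

/-- The kernels of Minkowski diversities: closed convex sets with nonempty interior. -/
structure IsKernel {k : ℕ} (K : Set (EuclideanSpace ℝ (Fin k))) : Prop where
  isClosed : IsClosed K
  convex : Convex ℝ K
  interior_nonempty : (interior K).Nonempty

/-- The Minkowski diversity with kernel `K`: the generalized circumradius with respect to `K`. -/
noncomputable def minkowski {k : ℕ} (K : Set (EuclideanSpace ℝ (Fin k)))
    (A : Finset (EuclideanSpace ℝ (Fin k))) : ℝ :=
  sInf {r : ℝ | 0 ≤ r ∧ ∃ x : EuclideanSpace ℝ (Fin k),
    (A : Set (EuclideanSpace ℝ (Fin k))) ⊆ r • K + {x}}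

/-- `K` is a simplex: the convex hull of a finite nonempty affinely independent family. -/
def IsSimplex {k : ℕ} (K : Set (EuclideanSpace ℝ (Fin k))) : Prop :=
  ∃ (n : ℕ) (s : Affine.Simplex ℝ (EuclideanSpace ℝ (Fin k)) n),
    K = convexHull ℝ (Set.range s.points)

/-- `(X, δ)` embeds isometrically into a Minkowski diversity whose kernel is a simplex. -/
def IsSimplexMinkowskiEmbeddable {X : Type*} (δ : Finset X → ℝ) : Prop :=
  ∃ (k : ℕ) (K : Set (EuclideanSpace ℝ (Fin k))) (f : X → EuclideanSpace ℝ (Fin k)),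
    IsKernel K ∧ IsSimplex K ∧ IsIsometricEmbedding δ (minkowski K) f

end Diversity

/-! A linear diversity is monotone and Minkowski additive, so an inequality `∑ c i * h_{S i} ≤ 0`
between support functions in every direction passes to `∑ c i * δ (S i) ≤ 0`
(`IsMinkowskiLinear.sum_nonpos`). The support function of a union is the maximum of the two, so
negative type reduces to that of the kernel `max`.

For the converse, Möbius inversion writes `δ A = -∑_{V ⊇ A} w V`, and alternating test vectors turn
negative type into `0 ≤ w V` for `V ≠ ∅, univ`. Then `w V * [A ⊄ V]` is the maximum over `A` of a
function on `X`, and `δ` becomes a sum of maxima of functions whose pointwise sum is zero.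

By `minkowski_simplex`, simplex kernels give exactly such sums, with the linear parts of barycentric
coordinates (up to sign) as the functions. Each term is Minkowski additive, so these diversities are
also linear, which closes the cycle. -/

namespace Diversity

/-- The kernel `max` is of negative type. -/
theorem sum_mul_mul_max_nonpos {ι : Type*} (s : Finset ι) (x p : ι → ℝ) (hx : ∑ i ∈ s, x i = 0) :
    ∑ i ∈ s, ∑ j ∈ s, x i * x j * max (p i) (p j) ≤ 0 := by
  obtain ⟨M, hM⟩ : ∃ M, ∀ i ∈ s, p i ≤ M := by
    obtain ⟨M, hM⟩ := (s.image p).bddAbove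
    exact ⟨M, fun i hi => hM (by simpa using ⟨i, hi, rfl⟩)⟩
  -- `M - max (p i) (p j)` is the length of `[p i, M) ∩ [p j, M)`, an `L²` inner product of
  -- indicators, so it is a positive semidefinite kernel. The constant `M` drops out because `x`
  -- sums to zero.
  let e : ι → ℝ → ℝ := fun i => (Set.Ico (p i) M).indicator 1
  have hprod (i j) : (fun t => e i t * e j t) = (Set.Ico (max (p i) (p j)) M).indicator 1 := by
    rw [← min_self M, ← Set.Ico_inter_Ico, Set.inter_indicator_one]
    rfl
  have hint (i j) : MeasureTheory.Integrable (fun t => e i t * e j t) := by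
    rw [hprod]
    exact (MeasureTheory.integrableOn_const (by simp)).integrable_indicator measurableSet_Ico
  have hval (i) (hi : i ∈ s) (j) (hj : j ∈ s) : ∫ t, e i t * e j t = M - max (p i) (p j) := by
    rw [hprod, MeasureTheory.integral_indicator_one measurableSet_Ico, Real.volume_real_Ico_of_le]
    exact max_le (hM i hi) (hM j hj)
  have key : ∑ i ∈ s, ∑ j ∈ s, x i * x j * (M - max (p i) (p j))
      = ∫ t, (∑ i ∈ s, x i * e i t) ^ 2 := by
    have : ∀ t, (∑ i ∈ s, x i * e i t) ^ 2 = ∑ i ∈ s, ∑ j ∈ s, x i * x j * (e i t * e j t) := by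
      intro t
      rw [sq, Finset.sum_mul_sum]
      exact Finset.sum_congr rfl fun i _ => Finset.sum_congr rfl fun j _ => by ring
    simp_rw [this]
    rw [MeasureTheory.integral_finsetSum _ fun i _ =>
      MeasureTheory.integrable_finsetSum _ fun j _ => (hint i j).const_mul _]
    refine Finset.sum_congr rfl fun i hi => ?_
    rw [MeasureTheory.integral_finsetSum _ fun j _ => (hint i j).const_mul _]
    refine Finset.sum_congr rfl fun j hj => ?_
    rw [MeasureTheory.integral_const_mul, hval i hi j hj]
  have hnn : 0 ≤ ∑ i ∈ s, ∑ j ∈ s, x i * x j * (M - max (p i) (p j)) := by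
    rw [key]
    exact MeasureTheory.integral_nonneg fun t => sq_nonneg _
  have hzero : ∑ i ∈ s, ∑ j ∈ s, x i * x j * M = 0 := by
    simp_rw [← Finset.sum_mul, ← Finset.mul_sum, hx]
    simp
  simp_rw [mul_sub, Finset.sum_sub_distrib, hzero] at hnn
  linarith

/-! ### Linear diversities have negative type. -/

section Linear

open scoped Classical

theorem IsDiversity.mono {X : Type*} {δ : Finset X → ℝ} (hδ : IsDiversity δ) {A B : Finset X}
    (h : A ⊆ B) : δ A ≤ δ B := by
  have step (C : Finset X) (b : X) : δ C ≤ δ (insert b C) := by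
    -- The empty third set leaves `δ {b} = 0` as the second summand.
    have h1 := hδ.triangle C {b} ∅ (by simp)
    have h2 : δ ({b} ∪ ∅) = 0 := (hδ.eq_zero_iff _).2 (by simp)
    rw [h2, Finset.union_empty, add_zero, Finset.union_comm, ← Finset.insert_eq] at h1
    exact h1
  have key (D : Finset X) : δ A ≤ δ (D ∪ A) := by
    induction D using Finset.induction_on with
    | empty => simp
    | insert b D _ ih => rw [Finset.insert_union]; exact ih.trans (step _ _)
  simpa [Finset.union_eq_left.2 h] using key B

variable {k : ℕ} {δ : Finset (EuclideanSpace ℝ (Fin k)) → ℝ} {ι : Type*}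

theorem sum_mem_sum {E : Type*} [AddCommMonoid E] [DecidableEq E] {s : Finset ι} {S : ι → Finset E} {g : ι → E}
    (h : ∀ i ∈ s, g i ∈ S i) : ∑ i ∈ s, g i ∈ ∑ i ∈ s, S i := by
  induction s using Finset.induction_on with
  | empty => simp
  | insert i s hi ih =>
    rw [Finset.sum_insert hi, Finset.sum_insert hi]
    exact Finset.add_mem_add (h i (by simp)) (ih fun j hj => h j (by simp [hj]))

theorem map_le_sum_of_mem_sum {E : Type*} [AddCommMonoid E] [DecidableEq E] {s : Finset ι} {S : ι → Finset E}
    {c : ι → ℝ} (u : E →+ ℝ) (h : ∀ i ∈ s, ∀ a ∈ S i, u a ≤ c i) {a : E}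
    (ha : a ∈ ∑ i ∈ s, S i) : u a ≤ ∑ i ∈ s, c i := by
  induction s using Finset.induction_on generalizing a with
  | empty => simp_all
  | insert i s hi ih =>
    rw [Finset.sum_insert hi] at ha ⊢
    obtain ⟨y, hy, z, hz, rfl⟩ := Finset.mem_add.1 ha
    rw [map_add]
    exact add_le_add (h i (by simp) y hy) (ih (fun j hj => h j (by simp [hj])) hz)

theorem sum_nonempty {E : Type*} [AddCommMonoid E] [DecidableEq E] {s : Finset ι} {S : ι → Finset E}
    (h : ∀ i ∈ s, (S i).Nonempty) : (∑ i ∈ s, S i).Nonempty := by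
  choose! g hg using h
  exact ⟨_, sum_mem_sum hg⟩

theorem IsMinkowskiLinear.sum_smul (hl : IsMinkowskiLinear δ) (hδ : IsDiversity δ) {s : Finset ι}
    {S : ι → Finset (EuclideanSpace ℝ (Fin k))} {c : ι → ℝ} (hc : ∀ i ∈ s, 0 ≤ c i)
    (hS : ∀ i ∈ s, (S i).Nonempty) : δ (∑ i ∈ s, c i • S i) = ∑ i ∈ s, c i * δ (S i) := by
  induction s using Finset.induction_on with
  | empty => simpa using (hδ.eq_zero_iff 0).2 (by simp)
  | insert i s hi ih =>
    rw [Finset.sum_insert hi, Finset.sum_insert hi, hl.add, hl.smul _ _ (hc i (by simp))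
      (hS i (by simp)), ih (fun j hj => hc j (by simp [hj])) (fun j hj => hS j (by simp [hj]))]
    · exact (hS i (by simp)).smul_finset
    · exact sum_nonempty fun j hj => (hS j (by simp [hj])).smul_finset

/-- If `a = ∑ w b • b`, then `∑ w b • B` contains both `a` and `B`, while linearity gives it the
value `(∑ w b) * δ B = δ B`. -/
theorem IsMinkowskiLinear.insert_le (hl : IsMinkowskiLinear δ) (hδ : IsDiversity δ)
    {a : EuclideanSpace ℝ (Fin k)} {B : Finset (EuclideanSpace ℝ (Fin k))}
    (ha : a ∈ convexHull ℝ (B : Set (EuclideanSpace ℝ (Fin k)))) : δ (insert a B) ≤ δ B := by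
  obtain ⟨w, hw, hw1, rfl⟩ := Finset.mem_convexHull'.1 ha
  have hB : ∀ b ∈ B, B.Nonempty := fun b hb => ⟨b, hb⟩
  have h := hl.sum_smul hδ (S := fun _ => B) hw hB
  rw [← Finset.sum_mul, hw1, one_mul] at h
  rw [← h]
  refine hδ.mono (Finset.insert_subset ?_ fun b hb => ?_)
  · exact sum_mem_sum fun b hb => Finset.smul_mem_smul_finset hb
  · have : b = ∑ y ∈ B, w y • b := by rw [← Finset.sum_smul, hw1, one_smul]
    rw [this]
    exact sum_mem_sum fun _ _ => Finset.smul_mem_smul_finset hb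

theorem IsMinkowskiLinear.le_of_subset_convexHull (hl : IsMinkowskiLinear δ) (hδ : IsDiversity δ)
    {P Q : Finset (EuclideanSpace ℝ (Fin k))}
    (h : (P : Set (EuclideanSpace ℝ (Fin k))) ⊆ convexHull ℝ Q) : δ P ≤ δ Q := by
  refine (hδ.mono Finset.subset_union_left).trans (?_ : δ (P ∪ Q) ≤ δ Q)
  induction P using Finset.induction_on with
  | empty => simp
  | insert a P _ ih =>
    rw [Finset.coe_insert, Set.insert_subset_iff] at h
    rw [Finset.insert_union]
    exact (hl.insert_le hδ (convexHull_mono (by simp) h.1)).trans (ih h.2)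

/-- A linear diversity is a positive functional of support functions. -/
theorem IsMinkowskiLinear.sum_nonpos (hl : IsMinkowskiLinear δ) (hδ : IsDiversity δ) (s : Finset ι)
    (S : ι → Finset (EuclideanSpace ℝ (Fin k))) (hS : ∀ i ∈ s, (S i).Nonempty) (c : ι → ℝ)
    (h : ∀ (u : StrongDual ℝ (EuclideanSpace ℝ (Fin k))) (m : ι → ℝ),
      (∀ i ∈ s, IsGreatest (u '' S i) (m i)) → ∑ i ∈ s, c i * m i ≤ 0) :
    ∑ i ∈ s, c i * δ (S i) ≤ 0 := by
  -- Splitting `c` by sign, it suffices that the positive Minkowski combination lies in the hull of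
  -- the negative one. A point outside would be separated by some `u`, in which direction `h` fails.
  have hsub : ((∑ i ∈ s, (c i)⁺ • S i : Finset (EuclideanSpace ℝ (Fin k))) :
      Set (EuclideanSpace ℝ (Fin k))) ⊆
      convexHull ℝ ((∑ i ∈ s, (c i)⁻ • S i : Finset (EuclideanSpace ℝ (Fin k))) :
        Set (EuclideanSpace ℝ (Fin k))) := by
    intro p hp
    by_contra hpQ
    obtain ⟨u, r, hu, hr⟩ := geometric_hahn_banach_closed_point (convex_convexHull ℝ _)
      ((Finset.finite_toSet _).isClosed_convexHull ℝ) hpQ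
    have hex : ∀ i ∈ s, ∃ a ∈ S i, ∀ b ∈ S i, u b ≤ u a := fun i hi =>
      (S i).exists_max_image u (hS i hi)
    choose! g hg hmax using hex
    have h1 : u p ≤ ∑ i ∈ s, (c i)⁺ * u (g i) := by
      refine map_le_sum_of_mem_sum (u : EuclideanSpace ℝ (Fin k) →+ ℝ) (fun i hi a ha => ?_) hp
      obtain ⟨b, hb, rfl⟩ := Finset.mem_smul_finset.1 ha
      simpa using mul_le_mul_of_nonneg_left (hmax i hi b hb) (posPart_nonneg (c i))
    have h2 := hu _ (subset_convexHull ℝ _ (sum_mem_sum (s := s) (S := fun i => (c i)⁻ • S i)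
      (g := fun i => (c i)⁻ • g i) fun i hi => Finset.smul_mem_smul_finset (hg i hi)))
    have h3 := h u (fun i => u (g i)) fun i hi =>
      ⟨⟨g i, hg i hi, rfl⟩, by rintro _ ⟨b, hb, rfl⟩; exact hmax i hi b hb⟩
    have h4 : ∑ i ∈ s, c i * u (g i) = ∑ i ∈ s, (c i)⁺ * u (g i) - ∑ i ∈ s, (c i)⁻ * u (g i) := by
      rw [← Finset.sum_sub_distrib]
      exact Finset.sum_congr rfl fun i _ => by rw [← sub_mul, posPart_sub_negPart]
    simp only [map_sum, map_smul, smul_eq_mul] at h2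
    linarith
  have := hl.le_of_subset_convexHull hδ hsub
  rw [hl.sum_smul hδ (fun i _ => posPart_nonneg _) hS,
    hl.sum_smul hδ (fun i _ => negPart_nonneg _) hS, ← sub_nonpos, ← Finset.sum_sub_distrib] at this
  simpa only [← sub_mul, posPart_sub_negPart] using this

theorem IsLinearEmbeddable.hasNegativeType {X : Type*} [Fintype X] {δ : Finset X → ℝ}
    (h : IsLinearEmbeddable δ) : HasNegativeType δ := by
  obtain ⟨k, δ', f, hδ', hl, hf⟩ := h
  have hf (A : Finset X) : δ A = δ' (A.image f) := by
    rw [← hf A]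
    congr!
  intro x hx0 hx
  -- The empty set has no support function; it is discarded using `x ∅ = 0`.
  let s : Finset (Finset X) := Finset.univ.erase ∅
  have hs : ∀ A ∈ s, A.Nonempty := fun A hA => by simpa [s, Finset.nonempty_iff_ne_empty] using hA
  have hxs : ∑ A ∈ s, x A = 0 := by rw [← hx]; exact Finset.sum_erase _ hx0
  have hsum : ∑ A, ∑ B, x A * x B * δ (A ∪ B) =
      ∑ q ∈ s ×ˢ s, x q.1 * x q.2 * δ' ((q.1 ∪ q.2).image f) := by
    simp_rw [← hf]
    rw [Finset.sum_product, ← Finset.sum_erase (a := ∅) Finset.univ (by simp [hx0])]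
    exact Finset.sum_congr rfl fun A _ => (Finset.sum_erase _ (by simp [hx0])).symm
  rw [hsum]
  refine hl.sum_nonpos hδ' _ (fun q : Finset X × Finset X => (q.1 ∪ q.2).image f)
    (fun q hq => ?_) (fun q => x q.1 * x q.2) fun u m hm => ?_
  · exact ((hs _ (Finset.mem_product.1 hq).1).mono Finset.subset_union_left).image f
  · have hmax : ∀ q ∈ s ×ˢ s, m q = max (m (q.1, q.1)) (m (q.2, q.2)) := by
      intro q hq
      obtain ⟨h1, h2⟩ := Finset.mem_product.1 hq
      have hu := (hm (q.1, q.1) (Finset.mk_mem_product h1 h1)).union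
        (hm (q.2, q.2) (Finset.mk_mem_product h2 h2))
      refine (hm q hq).unique ?_
      simpa only [Finset.union_self, Finset.image_union, Finset.coe_union, Set.image_union] using hu
    rw [Finset.sum_congr rfl fun q hq => by rw [hmax q hq], Finset.sum_product]
    exact sum_mul_mul_max_nonpos s x (fun A => m (A, A)) hxs

end Linear

/-! ### Minkowski diversities of simplices in barycentric coordinates. -/

section Simplex

open scoped Classical

variable {k : ℕ} {ι : Type*} (b : AffineBasis ι ℝ (EuclideanSpace ℝ (Fin k)))

theorem coord_eq_add_linear (i : ι) (x : EuclideanSpace ℝ (Fin k)) :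
    b.coord i x = b.coord i 0 + (b.coord i).linear x := by
  have := (b.coord i).map_vadd 0 x
  simp only [vadd_eq_add, add_zero] at this
  rw [this, add_comm]

theorem sum_coord_linear [Fintype ι] (x : EuclideanSpace ℝ (Fin k)) : ∑ i, (b.coord i).linear x = 0 := by
  have h1 := b.sum_coord_apply_eq_one x
  have h0 := b.sum_coord_apply_eq_one 0
  simp_rw [coord_eq_add_linear b _ x, Finset.sum_add_distrib, h0] at h1
  linarith

theorem eq_of_coord_linear_eq [Finite ι] {x y : EuclideanSpace ℝ (Fin k)}
    (h : ∀ i, (b.coord i).linear x = (b.coord i).linear y) : x = y :=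
  b.ext_elem fun i => by rw [coord_eq_add_linear, h, ← coord_eq_add_linear]

/-- With `sum_coord_linear` and `eq_of_coord_linear_eq`, this identifies `ℝ^k` with the zero-sum
hyperplane of `ι → ℝ`. -/
theorem exists_coord_linear_eq [Fintype ι] (t : ι → ℝ) (ht : ∑ i, t i = 0) :
    ∃ x, ∀ i, (b.coord i).linear x = t i := by
  refine ⟨∑ i, t i • b i, fun j => ?_⟩
  have h (i : ι) : (b.coord j).linear (b i) = (if j = i then 1 else 0) - b.coord j 0 := by
    rw [← b.coord_apply, coord_eq_add_linear b j (b i)]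
    ring
  simp_rw [map_sum, map_smul, h, smul_eq_mul, mul_sub, Finset.sum_sub_distrib, ← Finset.sum_mul, ht]
  simp

/-- The minimum over `A` of the linear part of the `i`-th barycentric coordinate. -/
noncomputable def coordMin (A : Finset (EuclideanSpace ℝ (Fin k))) (hA : A.Nonempty) (i : ι) : ℝ :=
  A.inf' hA (b.coord i).linear

variable {b} {A : Finset (EuclideanSpace ℝ (Fin k))} (hA : A.Nonempty)

theorem coordMin_le {a : EuclideanSpace ℝ (Fin k)} (ha : a ∈ A) (i : ι) :
    coordMin b A hA i ≤ (b.coord i).linear a :=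
  Finset.inf'_le _ ha

theorem le_coordMin {r : ℝ} {i : ι} (h : ∀ a ∈ A, r ≤ (b.coord i).linear a) :
    r ≤ coordMin b A hA i :=
  Finset.le_inf' _ _ h

theorem exists_coordMin_eq (b : AffineBasis ι ℝ (EuclideanSpace ℝ (Fin k))) (i : ι) :
    ∃ a ∈ A, coordMin b A hA i = (b.coord i).linear a :=
  Finset.exists_mem_eq_inf' hA _

variable [Fintype ι]

theorem sum_coordMin_nonpos : ∑ i, coordMin b A hA i ≤ 0 := by
  obtain ⟨a, ha⟩ := hA
  rw [← sum_coord_linear b a]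
  exact Finset.sum_le_sum fun i _ => coordMin_le _ ha i

theorem eq_of_sum_coordMin_eq_zero (h : ∑ i, coordMin b A hA i = 0)
    {x : EuclideanSpace ℝ (Fin k)} (hx : x ∈ A) (i : ι) :
    coordMin b A hA i = (b.coord i).linear x := by
  rw [← sum_coord_linear b x] at h
  exact (Finset.sum_eq_sum_iff_of_le fun i _ => coordMin_le hA hx i).1 h i (Finset.mem_univ i)

/-- The generalized circumradius with respect to a simplex. -/
theorem minkowski_simplex (b : AffineBasis ι ℝ (EuclideanSpace ℝ (Fin k))) :
    minkowski (convexHull ℝ (Set.range b)) A = -∑ i, coordMin b A hA i := by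
  have hK : ∀ y, y ∈ convexHull ℝ (Set.range b) ↔ ∀ i, 0 ≤ b.coord i y := by
    simp [b.convexHull_eq_nonneg_coord]
  refine IsLeast.csInf_eq ⟨⟨by linarith [sum_coordMin_nonpos (b := b) hA], ?_⟩, ?_⟩
  -- `A ⊆ r • K + x` requires `L i x ≤ r * b.coord i 0 + coordMin b A hA i` for all `i`, where `L i`
  -- is the linear part of `b.coord i`. Summing gives the lower bound on `r`; at the optimum all of
  -- these are equalities, which determines `x`.
  · set r := -∑ i, coordMin b A hA i with hr
    obtain ⟨x, hx⟩ := exists_coord_linear_eq b (fun i => r * b.coord i 0 + coordMin b A hA i)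
      (by rw [Finset.sum_add_distrib, ← Finset.mul_sum, b.sum_coord_apply_eq_one, hr]; ring)
    refine ⟨x, fun a ha => ?_⟩
    rw [Set.add_singleton]
    -- At `r = 0` the dilate `0 • K` is `{0}`, and `A` must reduce to the point `x`.
    rcases eq_or_ne r 0 with h0 | h0
    · refine ⟨0, ?_, (?_ : 0 + x = a)⟩
      · rw [h0, Set.zero_smul_set]
        · exact Set.mem_zero.2 rfl
        · have := b.nonempty
          exact (Set.range_nonempty b).convexHull
      · rw [zero_add x]
        refine eq_of_coord_linear_eq b fun i => ?_
        rw [hx, h0, eq_of_sum_coordMin_eq_zero hA (by linarith) ha]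
        ring
    · have hr0 : 0 < r := lt_of_le_of_ne (by linarith [sum_coordMin_nonpos (b := b) hA]) h0.symm
      refine ⟨a - x, ?_, by simp⟩
      rw [Set.mem_smul_set_iff_inv_smul_mem₀ h0, hK]
      intro i
      have h1 := coordMin_le (b := b) hA ha i
      rw [coord_eq_add_linear, map_smul, map_sub, hx, smul_eq_mul]
      have : b.coord i 0 + r⁻¹ * ((b.coord i).linear a - (r * b.coord i 0 + coordMin b A hA i))
          = r⁻¹ * ((b.coord i).linear a - coordMin b A hA i) := by
        field_simp
        ring
      rw [this]
      exact mul_nonneg (inv_nonneg.2 hr0.le) (by linarith)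
  · rintro r ⟨hr, x, hx⟩
    have h : ∑ i, (-r * b.coord i 0 + (b.coord i).linear x) ≤ ∑ i, coordMin b A hA i := by
      refine Finset.sum_le_sum fun i _ => le_coordMin hA fun a ha => ?_
      have ha' := hx (Finset.mem_coe.2 ha)
      rw [Set.add_singleton] at ha'
      obtain ⟨_, ⟨y, hy, rfl⟩, rfl⟩ := ha'
      have h1 := mul_nonneg hr ((hK y).1 hy i)
      rw [coord_eq_add_linear] at h1
      simp only [map_add, map_smul, smul_eq_mul]
      linarith
    rw [Finset.sum_add_distrib, ← Finset.mul_sum, b.sum_coord_apply_eq_one, sum_coord_linear] at h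
    linarith

theorem minkowski_empty (K : Set (EuclideanSpace ℝ (Fin k))) : minkowski K ∅ = 0 :=
  IsLeast.csInf_eq ⟨by simp, fun _ h => h.1⟩

/-- Fix `x ∈ B`. In each coordinate the minimum over `A ∪ C` is attained in `A` or in `C`; the union
of that set with `B` has a minimum at most this value, and the other union has one at most the value
at `x`. The contributions of `x` sum to zero. -/
theorem minkowski_simplex_union_le (b : AffineBasis ι ℝ (EuclideanSpace ℝ (Fin k)))
    (A B C : Finset (EuclideanSpace ℝ (Fin k))) (hB : B.Nonempty) :
    minkowski (convexHull ℝ (Set.range b)) (A ∪ C) ≤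
      minkowski (convexHull ℝ (Set.range b)) (A ∪ B) +
        minkowski (convexHull ℝ (Set.range b)) (B ∪ C) := by
  have hAB : (A ∪ B).Nonempty := hB.mono Finset.subset_union_right
  have hBC : (B ∪ C).Nonempty := hB.mono Finset.subset_union_left
  rw [minkowski_simplex hAB, minkowski_simplex hBC]
  rcases (A ∪ C).eq_empty_or_nonempty with h | hAC
  · rw [h, minkowski_empty]
    linarith [sum_coordMin_nonpos (b := b) hAB, sum_coordMin_nonpos (b := b) hBC]
  rw [minkowski_simplex hAC]
  obtain ⟨x, hx⟩ := id hB
  have : ∑ i, (coordMin b _ hAB i + coordMin b _ hBC i) ≤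
      ∑ i, (coordMin b _ hAC i + (b.coord i).linear x) := by
    refine Finset.sum_le_sum fun i _ => ?_
    obtain ⟨a, ha, he⟩ := exists_coordMin_eq hAC b i
    rw [he]
    have h1 := coordMin_le (b := b) hAB (Finset.mem_union_right A hx) i
    have h2 := coordMin_le (b := b) hBC (Finset.mem_union_left C hx) i
    rcases Finset.mem_union.1 ha with ha | ha
    · linarith [coordMin_le (b := b) hAB (Finset.mem_union_left B ha) i]
    · linarith [coordMin_le (b := b) hBC (Finset.mem_union_right B ha) i]
  rw [Finset.sum_add_distrib, Finset.sum_add_distrib, sum_coord_linear] at this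
  linarith

theorem isDiversity_minkowski_simplex (b : AffineBasis ι ℝ (EuclideanSpace ℝ (Fin k))) :
    IsDiversity (minkowski (convexHull ℝ (Set.range b))) where
  nonneg A := Real.sInf_nonneg fun _ h => h.1
  eq_zero_iff A := by
    rcases A.eq_empty_or_nonempty with rfl | hA
    · simp [minkowski_empty]
    rw [minkowski_simplex hA, neg_eq_zero, Finset.card_le_one]
    constructor
    · intro h x hx y hy
      refine eq_of_coord_linear_eq b fun i => ?_
      rw [← eq_of_sum_coordMin_eq_zero hA h hx, ← eq_of_sum_coordMin_eq_zero hA h hy]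
    · intro h
      obtain ⟨x, hx⟩ := id hA
      rw [← sum_coord_linear b x]
      refine Finset.sum_congr rfl fun i _ => ?_
      obtain ⟨a, ha, he⟩ := exists_coordMin_eq hA b i
      rw [he, h a ha x hx]
  triangle A B C hB := by
    convert minkowski_simplex_union_le b A B C hB

theorem isMinkowskiLinear_minkowski_simplex (b : AffineBasis ι ℝ (EuclideanSpace ℝ (Fin k))) :
    IsMinkowskiLinear (minkowski (convexHull ℝ (Set.range b))) where
  smul c A hc hA := by
    rw [minkowski_simplex hA, minkowski_simplex hA.smul_finset, mul_neg, Finset.mul_sum]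
    congr 1
    refine Finset.sum_congr rfl fun i _ => le_antisymm ?_ (le_coordMin _ fun a ha => ?_)
    · obtain ⟨a, ha, he⟩ := exists_coordMin_eq hA b i
      rw [he, ← smul_eq_mul, ← map_smul]
      exact coordMin_le _ (Finset.smul_mem_smul_finset ha) i
    · obtain ⟨y, hy, rfl⟩ := Finset.mem_smul_finset.1 ha
      rw [map_smul, smul_eq_mul]
      exact mul_le_mul_of_nonneg_left (coordMin_le hA hy i) hc
  add A B hA hB := by
    rw [minkowski_simplex hA, minkowski_simplex hB, minkowski_simplex (hA.add hB), ← neg_add,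
      ← Finset.sum_add_distrib]
    congr 1
    refine Finset.sum_congr rfl fun i _ => le_antisymm ?_ (le_coordMin _ fun a ha => ?_)
    · obtain ⟨x, hx, he⟩ := exists_coordMin_eq hA b i
      obtain ⟨y, hy, he'⟩ := exists_coordMin_eq hB b i
      rw [he, he', ← map_add]
      exact coordMin_le _ (Finset.add_mem_add hx hy) i
    · obtain ⟨x, hx, y, hy, rfl⟩ := Finset.mem_add.1 ha
      rw [map_add]
      exact add_le_add (coordMin_le hA hx i) (coordMin_le hB hy i)

theorem IsSimplexMinkowskiEmbeddable.isLinearEmbeddable {X : Type*} {δ : Finset X → ℝ}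
    (h : IsSimplexMinkowskiEmbeddable δ) : IsLinearEmbeddable δ := by
  obtain ⟨k, _, f, hK, ⟨n, s, rfl⟩, hf⟩ := h
  -- Nonempty interior forces the vertices to span the whole space.
  let b : AffineBasis (Fin (n + 1)) ℝ (EuclideanSpace ℝ (Fin k)) :=
    ⟨s.points, s.independent, by
      rw [← interior_convexHull_nonempty_iff_affineSpan_eq_top]
      exact hK.interior_nonempty⟩
  exact ⟨k, _, f, isDiversity_minkowski_simplex b, isMinkowskiLinear_minkowski_simplex b, hf⟩

/-- A sum of maxima of functions adding up to zero is a Minkowski diversity of a simplex. -/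
theorem isSimplexMinkowskiEmbeddable_of_sum_sup {X : Type*} [Nonempty ι]
    {δ : Finset X → ℝ} (h0 : δ ∅ = 0) (φ : ι → X → ℝ) (hφ : ∀ a, ∑ i, φ i a = 0)
    (h : ∀ (A : Finset X) (hA : A.Nonempty), δ A = ∑ i, A.sup' hA (φ i)) :
    IsSimplexMinkowskiEmbeddable δ := by
  obtain ⟨k, hk⟩ : ∃ k, Fintype.card ι = k + 1 :=
    Nat.exists_eq_succ_of_ne_zero Fintype.card_ne_zero
  obtain ⟨b⟩ := AffineBasis.exists_affineBasis_of_finiteDimensional (k := ℝ) (ι := ι)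
    (P := EuclideanSpace ℝ (Fin k)) (V := EuclideanSpace ℝ (Fin k)) (by simp [hk])
  -- The sign turns the minima of `minkowski_simplex` into maxima of `φ`.
  have hf (a : X) := exists_coord_linear_eq b (fun i => -φ i a) (by simp [hφ])
  choose f hf using hf
  let b' := b.reindex (Fintype.equivFinOfCardEq hk)
  refine ⟨k, convexHull ℝ (Set.range b), f,
    ⟨((Set.finite_range b).isCompact_convexHull ℝ).isClosed, convex_convexHull ℝ _,
      interior_convexHull_nonempty_iff_affineSpan_eq_top.2 b.tot⟩,
    ⟨k, ⟨b', b'.ind⟩, by simp [b', AffineBasis.coe_reindex]⟩, fun A => ?_⟩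
  rcases A.eq_empty_or_nonempty with rfl | hA
  · simp [minkowski_empty, h0]
  suffices minkowski (convexHull ℝ (Set.range b)) (A.image f) = δ A by
    rw [← this]
    congr!
  rw [minkowski_simplex (hA.image f), h A hA, ← Finset.sum_neg_distrib]
  refine Finset.sum_congr rfl fun i _ => le_antisymm ?_ (Finset.sup'_le _ _ fun a ha => ?_)
  · obtain ⟨x, hx, he⟩ := exists_coordMin_eq (hA.image f) b i
    obtain ⟨a, ha, rfl⟩ := Finset.mem_image.1 hx
    rw [he, hf, neg_neg]
    exact Finset.le_sup' _ ha
  · have := coordMin_le (b := b) (hA.image f) (Finset.mem_image_of_mem f ha) i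
    rw [hf] at this
    linarith

end Simplex

/-! ### From negative type to a simplex, by Möbius inversion. -/

section Moebius

open scoped Classical

variable {X : Type*} [Fintype X]

theorem sum_neg_one_pow_card_interval (V W : Finset X) :
    ∑ A, (if V ⊆ A ∧ A ⊆ W then (-1 : ℝ) ^ A.card else 0) =
      if V = W then (-1) ^ V.card else 0 := by
  have hIcc : Finset.univ.filter (fun A => V ⊆ A ∧ A ⊆ W) = Finset.Icc V W := by
    ext A
    simp
  rw [← Finset.sum_filter, hIcc]
  by_cases h : V ⊆ W
  · have hd : ∀ B ∈ (W \ V).powerset, Disjoint V B := fun B hB =>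
      Finset.disjoint_of_subset_right (Finset.mem_powerset.1 hB) Finset.disjoint_sdiff
    rw [Finset.Icc_eq_image_powerset h, Finset.sum_image]
    · rw [Finset.sum_congr rfl fun B hB => by
        rw [Finset.card_union_of_disjoint (hd B hB), pow_add], ← Finset.mul_sum]
      have := congrArg (Int.cast : ℤ → ℝ) (Finset.sum_powerset_neg_one_pow_card (x := W \ V))
      push_cast at this
      rw [this]
      have hVW : W \ V = ∅ ↔ V = W := by
        rw [Finset.sdiff_eq_empty_iff_subset]
        exact ⟨fun h' => h.antisymm h', fun h' => h' ▸ subset_rfl⟩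
      simp [hVW]
    · intro B hB C hC hBC
      rw [← Finset.union_sdiff_cancel_left (hd B hB), ← Finset.union_sdiff_cancel_left (hd C hC)]
      exact congrArg (· \ V) hBC
  · rw [Finset.Icc_eq_empty h, if_neg fun h' => h h'.subset, Finset.sum_empty]

/-- The weights in the expansion of `δ` in the functions `A ↦ -[A ⊆ V]`. -/
noncomputable def supersetWeight (δ : Finset X → ℝ) (V : Finset X) : ℝ :=
  -∑ W, if V ⊆ W then (-1) ^ V.card * (-1) ^ W.card * δ W else 0

theorem sum_supersetWeight (δ : Finset X → ℝ) (A : Finset X) :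
    ∑ V, (if A ⊆ V then supersetWeight δ V else 0) = -δ A := by
  have h (V : Finset X) : (if A ⊆ V then supersetWeight δ V else 0) =
      -∑ W, (if A ⊆ V ∧ V ⊆ W then (-1 : ℝ) ^ V.card else 0) * ((-1) ^ W.card * δ W) := by
    by_cases hA : A ⊆ V
    · simp [hA, supersetWeight, ite_mul, mul_assoc]
    · simp [hA]
  simp_rw [h]
  rw [Finset.sum_neg_distrib, Finset.sum_comm]
  simp_rw [← Finset.sum_mul, sum_neg_one_pow_card_interval]
  simp [← mul_assoc, ← mul_pow]

theorem HasNegativeType.supersetWeight_nonneg {δ : Finset X → ℝ} (h : HasNegativeType δ)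
    {V : Finset X} (h0 : V ≠ ∅) (h1 : V ≠ Finset.univ) : 0 ≤ supersetWeight δ V := by
  -- The sum of `x` over subsets of `W` vanishes unless `W = V`, so the quadratic form isolates
  -- `-supersetWeight δ V`. The case `W = univ` shows that `x` has total zero.
  let x : Finset X → ℝ := fun A => if V ⊆ A then (-1) ^ A.card else 0
  have hx (W : Finset X) : ∑ A, (if A ⊆ W then x A else 0) = if V = W then (-1) ^ V.card else 0 := by
    rw [← sum_neg_one_pow_card_interval]
    refine Finset.sum_congr rfl fun A _ => ?_
    simp only [x, ← ite_and, and_comm]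
  have hsum : ∑ A, ∑ B, x A * x B * δ (A ∪ B) = -supersetWeight δ V := by
    have hterm (A B : Finset X) : x A * x B * δ (A ∪ B) =
        -∑ W, supersetWeight δ W * ((if A ⊆ W then x A else 0) * (if B ⊆ W then x B else 0)) := by
      rw [← neg_neg (δ (A ∪ B)), ← sum_supersetWeight, mul_neg, Finset.mul_sum]
      congr 1
      refine Finset.sum_congr rfl fun W _ => ?_
      by_cases hA : A ⊆ W <;> by_cases hB : B ⊆ W <;> simp [hA, hB, Finset.union_subset_iff]
      ring
    have hswap : ∑ A, ∑ B, x A * x B * δ (A ∪ B) = -∑ W, supersetWeight δ W *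
        ((∑ A, if A ⊆ W then x A else 0) * ∑ B, if B ⊆ W then x B else 0) := by
      simp_rw [hterm, Finset.sum_neg_distrib, Finset.sum_mul_sum, Finset.mul_sum]
      rw [neg_inj]
      exact (Finset.sum_congr rfl fun A _ => Finset.sum_comm).trans Finset.sum_comm
    rw [hswap]
    simp_rw [hx]
    simp [← mul_pow]
  have := h x (by simp [x, h0]) (by simpa [h1] using hx Finset.univ)
  linarith

/-- For `V = univ` the sign of `c` is irrelevant, as no point lies outside `V`; negative type gives
no sign there. -/
theorem sup_ite_mem {A : Finset X} (hA : A.Nonempty) {V : Finset X} {c : ℝ}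
    (hc : V ≠ Finset.univ → 0 ≤ c) :
    A.sup' hA (fun a => if a ∈ V then 0 else c) = if A ⊆ V then 0 else c := by
  split_ifs with h
  · exact (Finset.sup'_congr hA rfl fun a ha => if_pos (h ha)).trans (Finset.sup'_const hA 0)
  · obtain ⟨a, ha, haV⟩ := Finset.not_subset.1 h
    have hc' := hc fun h' => haV (h' ▸ Finset.mem_univ a)
    refine le_antisymm (Finset.sup'_le _ _ fun b _ => ?_) ?_
    · split_ifs
      exacts [hc', le_rfl]
    · exact (if_neg haV).symm.le.trans (Finset.le_sup' (fun a => if a ∈ V then 0 else c) ha)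

theorem HasNegativeType.isSimplexMinkowskiEmbeddable {δ : Finset X → ℝ} (hδ : IsDiversity δ)
    (h : HasNegativeType δ) : IsSimplexMinkowskiEmbeddable δ := by
  let G := ∑ V ∈ Finset.univ.erase ∅, supersetWeight δ V
  -- The index `∅`, whose weight has no controlled sign and which contains no nonempty `A`, is
  -- reused for the constant `-G` that cancels the shifts `w V * [A ⊄ V] = w V - w V * [A ⊆ V]`.
  let φ : Finset X → X → ℝ := fun V a =>
    if V = ∅ then -G else if a ∈ V then 0 else supersetWeight δ V
  have key (A : Finset X) (hA : A.Nonempty) : δ A = ∑ V, A.sup' hA (φ V) := by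
    have hφ0 : A.sup' hA (φ ∅) = -G := by simp [φ]
    have hφ (V) (hV : V ∈ Finset.univ.erase ∅) : A.sup' hA (φ V) =
        supersetWeight δ V - if A ⊆ V then supersetWeight δ V else 0 := by
      have hV := Finset.ne_of_mem_erase hV
      simp only [φ, if_neg hV]
      rw [sup_ite_mem hA (h.supersetWeight_nonneg hV)]
      split_ifs <;> simp
    have hs := sum_supersetWeight δ A
    rw [← Finset.sum_erase Finset.univ (a := ∅)
      (if_neg fun h' => hA.ne_empty (Finset.subset_empty.1 h'))] at hs
    rw [← Finset.add_sum_erase _ _ (Finset.mem_univ ∅), hφ0, Finset.sum_congr rfl hφ,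
      Finset.sum_sub_distrib, hs]
    ring
  refine isSimplexMinkowskiEmbeddable_of_sum_sup ((hδ.eq_zero_iff _).2 (by simp)) φ (fun a => ?_) key
  -- On a singleton the maxima are values, so `δ {a} = 0` says that the `φ V a` sum to zero.
  have ha := key {a} (by simp)
  rw [(hδ.eq_zero_iff _).2 (by simp)] at ha
  simpa using ha.symm

end Moebius
end Diversity

theorem mainTheorem5 {X : Type*} [Fintype X] (δ : Finset X → ℝ) (hδ : Diversity.IsDiversity δ) :
    [Diversity.IsLinearEmbeddable δ,
      Diversity.HasNegativeType δ,
      Diversity.IsSimplexMinkowskiEmbeddable δ].TFAE := by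
  tfae_have 1 → 2 := fun h => h.hasNegativeType
  tfae_have 2 → 3 := fun h => h.isSimplexMinkowskiEmbeddable hδ
  tfae_have 3 → 1 := fun h => h.isLinearEmbeddable
  tfae_finish
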